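/- **Setting.** Let $\mathcal A=(Q,\delta,I,Q_F\cup\delta_F)$ be a nondeterministic Büchi automaton over an alphabet $\Sigma$: $Q$ is a finite set of states, $\delta\colon Q\times\Sigma\to 2^Q$, $I\subseteq Q$ is the set of initial states, $Q_F\subseteq Q$ the set of accepting states, and $\delta_F\subseteq\delta$ the set of accepting transitions. A run on $\alpha\in\Sigma^\omega$ is accepting if it visits some state of $Q_F$, or takes some transition of $\delta_F$, infinitely often. $L(\mathcal A)$ is the set of words that have an accepting run starting in $I$. For $R\subseteq Q$ put $\delta(R,a)=\bigcup_{q\in R}\delta(q,a)$. *Run DAG and ranks.* The run DAG $G_\alpha$ of a word $\alpha$ has as vertices the pairs $(q,i)\in Q\times\omega$ such that $q$ can be reached from a state of $I$ by a path labelled $\alpha_0\cdots\alpha_{i-1}$, and as edges the pairs $((q,i),(q',i+1))$ of vertices with $q'\in\delta(q,\alpha_i)$. Reachability is in zero or more steps. A vertex of a sub-DAG is finite if it reaches only finitely many vertices there. It is endangered if it reaches there neither a vertex $(q,i)$ with $q\in Q_F$ nor an edge whose underlying transition is in $\delta_F$. Let $G^0=G_\alpha$; for even $j$ let $G^{j+1}$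 be $G^j$ without its finite vertices, and for odd $j$ let $G^{j+1}$ be $G^j$ without its endangered vertices. The rank of a vertex $v$ is the $j\le 2|Q|$ with $v\in G^j\setminus G^{j+1}$, and $\omega$ if there is none. The level $\mathrm{level}_\alpha(k)$ is the set of all $q$ such that $(q,k)$ is a vertex of $G_\alpha$. Let $f^\alpha_k(q)$ be the rank of $(q,k)$ if $q\in \mathrm{level}_\alpha(k)$, and $0$ otherwise. *Tight levels.* A ranking is a function $f\colon Q\to\{0,\dots,2|Q|\}$ that is even on $Q_F$; its rank is its maximum. A ranking is tight if its rank $r$ is odd and it attains all of $1,3,\dots,r$. A level $\ell$ is tight for $\alpha$ if for all $k\ge\ell$ the function $f^\alpha_k$ is a tight ranking and has the same rank as $f^\alpha_\ell$. *TRUBs.* For $\mu\colon 2^Q\to\omega$ and $S\subseteq Q$ let $\inf(\mu)(S)$ be the function on $Q$ with value $\max\{\mu(S)-1,0\}$ at $q\in Q_F$ and $\mu(S)$ at $q\notin Q_F$. The map $\mu$ is a *tight rank upper bound (TRUB) with respect to $\alpha$* if there is a tight level $\ell$ for $\alpha$ such that $\inf(\mu)(\mathrm{level}_\alpha(k))\ge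 f^\alpha_k$ pointwise for all $k\ge\ell$. It is a *TRUB* if this holds for all $\alpha\notin L(\mathcal A)$. *Outer macrostate analysis.* The predecessors of $S\subseteq Q$ in the skeleton are the sets $R\subseteq Q$ with $\delta(R,a)=S$ for some $a\in\Sigma$. If these are $R_1,\dots,R_m$, put $$\mathrm{up}_{out}(\mu,S,R_1,\dots,R_m)=\min\{\mu(S),\max\{\mu(R_1),\dots,\mu(R_m)\}\},\qquad \max\emptyset=0.$$ The analysis started with $\mu_0$ repeatedly replaces the value $\mu(S)$ of one macrostate $S$, or of several macrostates simultaneously, in any order, by $\mathrm{up}_{out}(\mu,S,R_1,\dots,R_m)$. It returns $\mu$ once $\mu(S)=\mathrm{up}_{out}(\mu,S,R_1,\dots,R_m)$ holds for every $S\subseteq Q$. Steps that change nothing are not counted. **Lemma.** Let $\mu\colon 2^Q\to\omega$, let $S\subseteq Q$ have the skeleton predecessors $R_1,\dots,R_m$, and let $\mu'$ be $\mu$ with its value at $S$ replaced by $\mathrm{up}_{out}(\mu,S,R_1,\dots,R_m)$. If $\mu$ is a TRUB, then $\mu'$ is a TRUB. More precisely, for each $\alpha\notin L(\mathcal A)$,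 if $\mu$ is a TRUB with respect to $\alpha$, then so is $\mu'$. Moreover, if all values $\inf(\mu)(T)$, $T\subseteq Q$, are rankings, then so are all $\inf(\mu')(T)$. **Corollary.** Started with any $\mu_0\colon 2^Q\to\omega$, in particular with a TRUB, the outer macrostate analysis terminates: no execution has infinitely many steps. All executions return the same map $\mu^*_{out}$. If $\mu_0$ is a TRUB, then $\mu^*_{out}$ is a TRUB; the same holds for TRUBs with respect to any fixed $\alpha\notin L(\mathcal A)$. If all values of $\inf(\mu_0)$ are rankings, then so are all values of $\inf(\mu^*_{out})$. -/

import Mathlib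

open Filter

/-- A nondeterministic Büchi automaton with accepting states and accepting transitions:
`next q a` is the set of `a`-successors of `q` and `accNext q a` is the set of those successors
that are reached by an accepting transition. -/
structure BuchiAut (Q A : Type*) where
  next : Q → A → Set Q
  init : Set Q
  accStates : Set Q
  accNext : Q → A → Set Q
  accNext_subset : ∀ q a, accNext q a ⊆ next q a

namespace BuchiAut

variable {Q A : Type*} (M : BuchiAut Q A)

/-- The extension of the transition function to sets of states. -/
def post (P : Set Q) (a : A) : Set Q := {q | ∃ p ∈ P, q ∈ M.next p a}

/-- `ρ` is an (infinite) run on the word `α`. -/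
def IsRun (α : ℕ → A) (ρ : ℕ → Q) : Prop := ∀ i, ρ (i + 1) ∈ M.next (ρ i) (α i)

/-- Some accepting state, or some accepting transition, occurs infinitely often in `ρ`. -/
def IsAccepting (α : ℕ → A) (ρ : ℕ → Q) : Prop :=
  (∃ q ∈ M.accStates, ∃ᶠ i in atTop, ρ i = q) ∨
  (∃ q a, ∃ q' ∈ M.accNext q a, ∃ᶠ i in atTop, ρ i = q ∧ α i = a ∧ ρ (i + 1) = q')

/-- The language of the automaton. -/
def language : Set (ℕ → A) :=
  {α | ∃ ρ : ℕ → Q, ρ 0 ∈ M.init ∧ M.IsRun α ρ ∧ M.IsAccepting α ρ}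

/-! ### Run DAGs and ranks -/

/-- The vertices of the run DAG over `α`: `(q, i)` is a vertex iff some initial state
leads to `q` by a path labelled with the first `i` letters of `α`. -/
def dagVertices (α : ℕ → A) : Set (Q × ℕ) :=
  {v | ∃ ρ : ℕ → Q, ρ 0 ∈ M.init ∧ (∀ j < v.2, ρ (j + 1) ∈ M.next (ρ j) (α j)) ∧ ρ v.2 = v.1}

/-- The edges of the sub-DAG induced by the vertex set `V`. -/
def edgeIn (α : ℕ → A) (V : Set (Q × ℕ)) (v w : Q × ℕ) : Prop :=
  v ∈ V ∧ w ∈ V ∧ w.2 = v.2 + 1 ∧ w.1 ∈ M.next v.1 (α v.2)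

/-- Reachability (in zero or more steps) in the sub-DAG induced by `V`. -/
def reachIn (α : ℕ → A) (V : Set (Q × ℕ)) : Q × ℕ → Q × ℕ → Prop :=
  Relation.ReflTransGen (M.edgeIn α V)

/-- `v` is finite in the sub-DAG induced by `V`. -/
def FiniteVertex (α : ℕ → A) (V : Set (Q × ℕ)) (v : Q × ℕ) : Prop :=
  {w | M.reachIn α V v w}.Finite

/-- `v` is endangered in the sub-DAG induced by `V`: it reaches neither an accepting vertex
nor an accepting edge. -/
def Endangered (α : ℕ → A) (V : Set (Q × ℕ)) (v : Q × ℕ) : Prop :=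
  (∀ w, M.reachIn α V v w → w.1 ∉ M.accStates) ∧
  (∀ w u, M.reachIn α V v w → M.edgeIn α V w u → u.1 ∉ M.accNext w.1 (α w.2))

open Classical in
/-- The vertex set of the `j`-th DAG of the ranking procedure: finite vertices are removed from
DAGs with even index, endangered vertices from DAGs with odd index. -/
def dagIter (α : ℕ → A) : ℕ → Set (Q × ℕ)
  | 0 => M.dagVertices α
  | j + 1 => {v ∈ dagIter α j | ¬ (if Even j then M.FiniteVertex α (dagIter α j) v
      else M.Endangered α (dagIter α j) v)}

/-- The rank of a vertex: the index `j ≤ 2|Q|` of the step that removes it,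
and `⊤` (that is, `ω`) if there is none. -/
noncomputable def vertexRank [Fintype Q] (α : ℕ → A) (v : Q × ℕ) : ℕ∞ :=
  ⨅ j ∈ {j : ℕ | j ≤ 2 * Fintype.card Q ∧ v ∈ M.dagIter α j ∧ v ∉ M.dagIter α (j + 1)}, (j : ℕ∞)

/-- The `ℓ`-th level of the run DAG over `α`. -/
def level (α : ℕ → A) (l : ℕ) : Set Q := {q | (q, l) ∈ M.dagVertices α}

open Classical in
/-- The ranking of the `ℓ`-th level of the run DAG over `α`. -/
noncomputable def levelRanking [Fintype Q] (α : ℕ → A) (l : ℕ) (q : Q) : ℕ∞ :=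
  if q ∈ M.level α l then M.vertexRank α (q, l) else 0

/-! ### Rankings and tight rank upper bounds -/

/-- `f` takes values in `{0, …, 2|Q|}` and is even on accepting states. -/
def IsRanking [Fintype Q] (f : Q → ℕ∞) : Prop :=
  (∀ q, f q ≤ ((2 * Fintype.card Q : ℕ) : ℕ∞)) ∧
  ∀ q ∈ M.accStates, ∃ m : ℕ, Even m ∧ f q = (m : ℕ∞)

/-- The rank of a ranking: its maximal value. -/
noncomputable def rankOf (f : Q → ℕ∞) : ℕ∞ := ⨆ q, f q

/-- `f` is a ranking of odd rank `r` that attains each of the values `1, 3, …, r`. -/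
def IsTight [Fintype Q] (f : Q → ℕ∞) : Prop :=
  M.IsRanking f ∧ ∃ r : ℕ, Odd r ∧ rankOf f = (r : ℕ∞) ∧
    ∀ j : ℕ, Odd j → j ≤ r → ∃ q, f q = (j : ℕ∞)

/-- Level `ℓ` is tight in the run DAG over `α`. -/
def IsTightLevel [Fintype Q] (α : ℕ → A) (l : ℕ) : Prop :=
  ∀ k ≥ l, M.IsTight (M.levelRanking α k) ∧
    rankOf (M.levelRanking α k) = rankOf (M.levelRanking α l)

/-- `μ` is a tight rank upper bound with respect to the word `α`. -/
def IsTRUBWrt [Fintype Q] (α : ℕ → A) (μ : Set Q → Q → ℕ) : Prop :=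
  ∃ l, M.IsTightLevel α l ∧ ∀ k ≥ l, ∀ q, M.levelRanking α k q ≤ (μ (M.level α k) q : ℕ∞)

/-- `μ` is a tight rank upper bound: with respect to every word that is not accepted. -/
def IsTRUB [Fintype Q] (μ : Set Q → Q → ℕ) : Prop :=
  ∀ α, α ∉ M.language → M.IsTRUBWrt α μ

/-- All values of `μ` are rankings. -/
def IsRankingValued [Fintype Q] (μ : Set Q → Q → ℕ) : Prop :=
  ∀ S, M.IsRanking (fun q => (μ S q : ℕ∞))

open Classical in
/-- The map into rankings induced by a map `μ` into `ω`: the value `μ S` on non-accepting states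
and `μ S - 1` (truncated at `0`) on accepting states. -/
noncomputable def inf (μ : Set Q → ℕ) (S : Set Q) (q : Q) : ℕ :=
  if q ∈ M.accStates then μ S - 1 else μ S

/-! ### Outer macrostate analysis -/

/-- The predecessors of the macrostate `S` in the skeleton, whose transitions are
`R -a→ post R a` for all sets of states `R` and letters `a`. -/
def skeletonPred (S : Set Q) : Set (Set Q) := {R | ∃ a, M.post R a = S}

/-- The update function of the outer macrostate analysis (the maximum over no predecessors
is `0`). -/
noncomputable def updOut [Finite Q] (μ : Set Q → ℕ) (S : Set Q) : ℕ :=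
  min (μ S) ((Set.toFinite (M.skeletonPred S)).toFinset.sup μ)

/-- One effective step of the fixpoint iteration: some macrostates (a single one, or several
at once) are updated from the current values, the others keep theirs, and something changes. -/
def OuterStep [Finite Q] (μ μ' : Set Q → ℕ) : Prop :=
  μ' ≠ μ ∧ ∀ S, μ' S = μ S ∨ μ' S = M.updOut μ S

/-- No execution of the iteration from `μ₀` performs infinitely many effective steps. -/
def OuterTerminates [Finite Q] (μ₀ : Set Q → ℕ) : Prop :=
  ¬ ∃ s : ℕ → Set Q → ℕ, s 0 = μ₀ ∧ ∀ i, M.OuterStep (s i) (s (i + 1))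

/-- `μ` solves the equation system `μ S = upd_out (μ, S, R₁, …, R_m)`, for all `S`. -/
def IsOuterSolution [Finite Q] (μ : Set Q → ℕ) : Prop := ∀ S, μ S = M.updOut μ S

/-- Some execution of the iteration from `μ₀` ends in `μ`, where all equations hold. -/
def OuterReturns [Finite Q] (μ₀ μ : Set Q → ℕ) : Prop :=
  Relation.ReflTransGen M.OuterStep μ₀ μ ∧ M.IsOuterSolution μ

end BuchiAut

namespace BuchiAut

variable {Q A : Type*} (M : BuchiAut Q A)

/-! ### Levels of the run DAG -/

/-! From a tight level on, all level rankings share one odd rank `r`. It is attained at a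
non-accepting state, while evenness keeps accepting states at most `r - 1`. Hence `inf μ` bounds the
ranking of a level exactly when `r ≤ μ` there (`rank_le_of_le_inf`, `le_inf_of_rank_le`). Each level
is a skeleton predecessor of the next, so the maximum in the update of a level is at least `r` once
the preceding level has value at least `r`; only the first level can lose its bound
(`IsTRUBWrt.of_updOut_le`). Steps strictly decrease a map from a finite set to `ℕ`, which forces
termination. The update is monotone, so every result is the greatest solution below the initial map,
hence unique. -/

theorem level_succ (α : ℕ → A) (k : ℕ) : M.level α (k + 1) = M.post (M.level α k) (α k) := by
  ext q
  constructor
  · rintro ⟨ρ, h0, hstep, hq⟩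
    refine ⟨ρ k, ⟨ρ, h0, fun j hj => hstep j (Nat.lt_succ_of_lt hj), rfl⟩, ?_⟩
    have h := hstep k (Nat.lt_succ_self k)
    dsimp only at hq
    rwa [hq] at h
  · rintro ⟨p, ⟨ρ, h0, hstep, hp⟩, hq⟩
    dsimp only at hp hstep
    -- The values after position `k + 1` are irrelevant, so the path is constantly `q` from there
    -- on.
    refine ⟨fun i => if i ≤ k then ρ i else q, by simpa using h0, fun j hj => ?_, by simp⟩
    dsimp only at hj
    rcases Nat.lt_succ_iff_lt_or_eq.mp hj with hj | rfl
    · have h1 : j ≤ k := hj.le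
      have h2 : j + 1 ≤ k := hj
      simpa [h1, h2] using hstep j hj
    · simpa [hp] using hq

theorem level_mem_skeletonPred (α : ℕ → A) (k : ℕ) :
    M.level α k ∈ M.skeletonPred (M.level α (k + 1)) :=
  ⟨α k, (M.level_succ α k).symm⟩

section
variable {M} [Fintype Q]

theorem IsTightLevel.mono {α : ℕ → A} {l l' : ℕ} (h : M.IsTightLevel α l) (hl : l ≤ l') :
    M.IsTightLevel α l' := fun k hk =>
  ⟨(h k (hl.trans hk)).1, (h k (hl.trans hk)).2.trans (h l' hl).2.symm⟩

/-- The odd rank of a tight ranking is attained at a non-accepting state. -/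
theorem IsTight.exists_odd {f : Q → ℕ∞} (h : M.IsTight f) :
    ∃ r : ℕ, Odd r ∧ rankOf f = (r : ℕ∞) ∧ ∃ q, q ∉ M.accStates ∧ f q = (r : ℕ∞) := by
  obtain ⟨⟨-, heven⟩, r, hr, hrank, hatt⟩ := h
  obtain ⟨q, hq⟩ := hatt r hr le_rfl
  refine ⟨r, hr, hrank, q, fun hacc => ?_, hq⟩
  obtain ⟨m, hm, hfm⟩ := heven q hacc
  have : r = m := by exact_mod_cast hq.symm.trans hfm
  exact Nat.not_even_iff_odd.mpr hr (this ▸ hm)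

/-- A ranking of odd rank at most `m` is bounded by `m - 1` on accepting states. -/
theorem IsRanking.le_pred {f : Q → ℕ∞} (hf : M.IsRanking f) {r m : ℕ} (hr : Odd r)
    (hrank : rankOf f = (r : ℕ∞)) (hrm : r ≤ m) {q : Q} (hq : q ∈ M.accStates) :
    f q ≤ ((m - 1 : ℕ) : ℕ∞) := by
  obtain ⟨n, hn, hfn⟩ := hf.2 q hq
  have hle : f q ≤ (r : ℕ∞) := hrank ▸ le_iSup f q
  rw [hfn] at hle ⊢
  have hle' : n ≤ r := by exact_mod_cast hle
  -- Opposite parities make the bound strict, which pays for the truncated subtraction.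
  have hne : n ≠ r := fun h => Nat.not_even_iff_odd.mpr hr (h ▸ hn)
  exact_mod_cast (show n ≤ m - 1 by omega)

/-- The rank is attained at a non-accepting state, where `inf` subtracts nothing. -/
theorem rank_le_of_le_inf {f : Q → ℕ∞} (hf : M.IsTight f) {r : ℕ} (hrank : rankOf f = (r : ℕ∞))
    {μ : Set Q → ℕ} {S : Set Q} (h : ∀ q, f q ≤ (M.inf μ S q : ℕ∞)) : r ≤ μ S := by
  obtain ⟨r', -, hrank', q, hq, hfq⟩ := hf.exists_odd
  obtain rfl : r' = r := by exact_mod_cast hrank'.symm.trans hrank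
  have := h q
  rw [hfq, inf, if_neg hq] at this
  exact_mod_cast this

theorem le_inf_of_rank_le {f : Q → ℕ∞} (hf : M.IsRanking f) {r : ℕ} (hr : Odd r)
    (hrank : rankOf f = (r : ℕ∞)) {μ : Set Q → ℕ} {S : Set Q} (h : r ≤ μ S) (q : Q) :
    f q ≤ (M.inf μ S q : ℕ∞) := by
  unfold inf
  split_ifs with hq
  · exact hf.le_pred hr hrank h hq
  · exact (hrank ▸ le_iSup f q : f q ≤ (r : ℕ∞)).trans (by exact_mod_cast h)

end

/-! ### The update function -/

section
variable [Finite Q]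

theorem updOut_le (μ : Set Q → ℕ) (S : Set Q) : M.updOut μ S ≤ μ S := min_le_left _ _

theorem min_le_updOut {μ : Set Q → ℕ} {R S : Set Q} (h : R ∈ M.skeletonPred S) :
    min (μ S) (μ R) ≤ M.updOut μ S :=
  min_le_min_left _ (Finset.le_sup (f := μ) ((Set.Finite.mem_toFinset _).mpr h))

theorem updOut_mono {μ ν : Set Q → ℕ} (h : μ ≤ ν) (S : Set Q) : M.updOut μ S ≤ M.updOut ν S :=
  min_le_min (h S) (Finset.sup_mono_fun fun R _ => h R)

theorem updOut_eq_zero_or (μ : Set Q → ℕ) (S : Set Q) :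
    M.updOut μ S = 0 ∨ ∃ T, M.updOut μ S = μ T := by
  unfold updOut
  rcases min_choice (μ S) ((Set.toFinite (M.skeletonPred S)).toFinset.sup μ) with h | h
  · exact Or.inr ⟨S, h⟩
  · rw [h]
    rcases (Set.toFinite (M.skeletonPred S)).toFinset.eq_empty_or_nonempty with he | hne
    · left
      rw [he, Finset.sup_empty, Nat.bot_eq_zero]
    · obtain ⟨T, -, hT⟩ := Finset.exists_mem_eq_sup _ hne μ
      exact Or.inr ⟨T, hT⟩

end

/-! ### Preservation of upper bounds by updates -/

section
variable {M} [Fintype Q]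

/-- Only a lower bound on `μ'` is needed, so single and simultaneous updates are covered alike. -/
theorem IsTRUBWrt.of_updOut_le {α : ℕ → A} {μ μ' : Set Q → ℕ} (h : M.IsTRUBWrt α (M.inf μ))
    (hμ : ∀ S, M.updOut μ S ≤ μ' S) : M.IsTRUBWrt α (M.inf μ') := by
  obtain ⟨l, hl, hle⟩ := h
  obtain ⟨r, hr, hrank, -⟩ := (hl l le_rfl).1.exists_odd
  have hrank' : ∀ k ≥ l, rankOf (M.levelRanking α k) = (r : ℕ∞) :=
    fun k hk => (hl k hk).2.trans hrank
  have hrμ : ∀ k ≥ l, r ≤ μ (M.level α k) :=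
    fun k hk => rank_le_of_le_inf (hl k hk).1 (hrank' k hk) (hle k hk)
  -- Level `l` may have no predecessor with value at least `r`; beyond it, the preceding level is
  -- such a predecessor.
  refine ⟨l + 1, hl.mono (Nat.le_succ l), fun k hk => ?_⟩
  obtain ⟨k, rfl⟩ := Nat.exists_eq_add_of_le' (Nat.one_le_of_lt hk)
  have hk' : l ≤ k := Nat.le_of_succ_le_succ hk
  have hk'' : l ≤ k + 1 := Nat.le_succ_of_le hk'
  refine le_inf_of_rank_le (hl _ hk'').1.1 hr (hrank' _ hk'') ?_
  exact (le_min (hrμ _ hk'') (hrμ _ hk')).trans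
    ((M.min_le_updOut (M.level_mem_skeletonPred α k)).trans (hμ _))

theorem IsRankingValued.of_eq_zero_or {μ μ' : Set Q → ℕ} (h : M.IsRankingValued (M.inf μ))
    (hμ : ∀ S, μ' S = 0 ∨ ∃ T, μ' S = μ T) : M.IsRankingValued (M.inf μ') := by
  intro S
  rcases hμ S with h0 | ⟨T, hT⟩
  · have : M.inf μ' S = fun _ => 0 := by
      funext q
      simp [inf, h0]
    rw [this]
    exact ⟨fun _ => by simp, fun _ _ => ⟨0, Even.zero, rfl⟩⟩
  · have : M.inf μ' S = M.inf μ T := by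
      funext q
      simp [inf, hT]
    rw [this]
    exact h T

end

/-! ### The fixpoint iteration -/

section
variable {M} [Finite Q]

theorem updOut_le_of_eq_or {μ μ' : Set Q → ℕ} (h : ∀ S, μ' S = μ S ∨ μ' S = M.updOut μ S)
    (S : Set Q) : M.updOut μ S ≤ μ' S := by
  rcases h S with h | h
  · exact h ▸ M.updOut_le μ S
  · exact h.ge

theorem eq_zero_or_of_eq_or {μ μ' : Set Q → ℕ} (h : ∀ S, μ' S = μ S ∨ μ' S = M.updOut μ S)
    (S : Set Q) : μ' S = 0 ∨ ∃ T, μ' S = μ T := by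
  rcases h S with h | h
  · exact Or.inr ⟨S, h⟩
  · exact h ▸ M.updOut_eq_zero_or μ S

theorem update_updOut_eq_or [DecidableEq (Set Q)] (μ : Set Q → ℕ) (S T : Set Q) :
    Function.update μ S (M.updOut μ S) T = μ T ∨
      Function.update μ S (M.updOut μ S) T = M.updOut μ T := by
  rcases eq_or_ne T S with rfl | hT
  · exact Or.inr (Function.update_self _ _ _)
  · exact Or.inl (Function.update_of_ne hT _ _)

theorem OuterStep.lt {μ μ' : Set Q → ℕ} (h : M.OuterStep μ μ') : μ' < μ := by
  refine lt_of_le_of_ne (fun S => ?_) h.1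
  rcases h.2 S with hS | hS
  · exact hS.le
  · exact hS ▸ M.updOut_le μ S

/-- By monotonicity, a solution below `μ` is below its update, whichever macrostates are chosen. -/
theorem OuterStep.solution_le {μ μ' ν : Set Q → ℕ} (h : M.OuterStep μ μ')
    (hν : M.IsOuterSolution ν) (hle : ν ≤ μ) : ν ≤ μ' := fun S =>
  (hν S).trans_le ((M.updOut_mono hle S).trans (updOut_le_of_eq_or h.2 S))

theorem outerTerminates (μ₀ : Set Q → ℕ) : M.OuterTerminates μ₀ := by
  rintro ⟨s, -, hs⟩
  exact (wellFounded_iff_isEmpty_descending_chain.mp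
    (wellFounded_lt (α := Set Q → ℕ))).false ⟨s, fun i => (hs i).lt⟩

theorem exists_outerReturns (μ₀ : Set Q → ℕ) : ∃ μs, M.OuterReturns μ₀ μs := by
  induction μ₀ using (wellFounded_lt (α := Set Q → ℕ)).induction with
  | _ μ ih =>
    by_cases h : M.IsOuterSolution μ
    · exact ⟨μ, .refl, h⟩
    -- Updating all macrostates at once changes something precisely because `μ` is not a solution.
    · have hstep : M.OuterStep μ (M.updOut μ) :=
        ⟨fun he => h fun S => (congrFun he S).symm, fun _ => Or.inr rfl⟩
      obtain ⟨μs, hreach, hsol⟩ := ih _ hstep.lt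
      exact ⟨μs, .head hstep hreach, hsol⟩

theorem OuterReturns.le {μ₀ μs : Set Q → ℕ} (h : M.OuterReturns μ₀ μs) : μs ≤ μ₀ := by
  obtain ⟨h, -⟩ := h
  induction h with
  | refl => exact le_rfl
  | tail _ hstep ih => exact hstep.lt.le.trans ih

/-- The result of the iteration is the greatest solution below the initial map. -/
theorem OuterReturns.solution_le {μ₀ μs ν : Set Q → ℕ} (h : M.OuterReturns μ₀ μs)
    (hν : M.IsOuterSolution ν) (hle : ν ≤ μ₀) : ν ≤ μs := by
  obtain ⟨h, -⟩ := h
  induction h with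
  | refl => exact hle
  | tail _ hstep ih => exact hstep.solution_le hν ih

theorem existsUnique_outerReturns (μ₀ : Set Q → ℕ) : ∃! μs, M.OuterReturns μ₀ μs := by
  obtain ⟨μs, h⟩ := M.exists_outerReturns μ₀
  exact ⟨μs, h, fun ν hν => le_antisymm (h.solution_le hν.2 hν.le) (hν.solution_le h.2 h.le)⟩

/-- A property preserved by all steps is inherited by the result of the iteration. -/
theorem OuterReturns.preserves {μ₀ μs : Set Q → ℕ} (h : M.OuterReturns μ₀ μs)
    {P : (Set Q → ℕ) → Prop} (hP : ∀ μ μ', M.OuterStep μ μ' → P μ → P μ') (h0 : P μ₀) :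
    P μs := by
  obtain ⟨h, -⟩ := h
  induction h with
  | refl => exact h0
  | tail _ hstep ih => exact hP _ _ hstep ih

end

end BuchiAut

open Classical in
theorem mainTheorem5 {Q A : Type*} [Fintype Q] (M : BuchiAut Q A) :
    -- a single update preserves tight rank upper bounds
    (∀ (μ : Set Q → ℕ) (S : Set Q),
      (∀ α, α ∉ M.language → M.IsTRUBWrt α (M.inf μ) →
        M.IsTRUBWrt α (M.inf (Function.update μ S (M.updOut μ S)))) ∧
      (M.IsTRUB (M.inf μ) → M.IsTRUB (M.inf (Function.update μ S (M.updOut μ S)))) ∧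
      (M.IsRankingValued (M.inf μ) →
        M.IsRankingValued (M.inf (Function.update μ S (M.updOut μ S))))) ∧
    -- the fixpoint iteration terminates, with a uniquely determined result
    (∀ μ₀ : Set Q → ℕ, M.OuterTerminates μ₀ ∧ ∃! μs, M.OuterReturns μ₀ μs) ∧
    -- the result of an iteration from a tight rank upper bound is one
    (∀ μ₀ μs : Set Q → ℕ, M.OuterReturns μ₀ μs →
      (∀ α, α ∉ M.language → M.IsTRUBWrt α (M.inf μ₀) → M.IsTRUBWrt α (M.inf μs)) ∧
      (M.IsTRUB (M.inf μ₀) → M.IsTRUB (M.inf μs)) ∧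
      (M.IsRankingValued (M.inf μ₀) → M.IsRankingValued (M.inf μs))) := by
  have trub : ∀ μ₀ μs : Set Q → ℕ, M.OuterReturns μ₀ μs → ∀ α,
      M.IsTRUBWrt α (M.inf μ₀) → M.IsTRUBWrt α (M.inf μs) := fun μ₀ μs h α =>
    h.preserves (P := fun μ => M.IsTRUBWrt α (M.inf μ)) fun _ _ hs hμ =>
      hμ.of_updOut_le (BuchiAut.updOut_le_of_eq_or hs.2)
  have trub_update : ∀ (μ : Set Q → ℕ) (S : Set Q) (α : ℕ → A), M.IsTRUBWrt α (M.inf μ) →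
      M.IsTRUBWrt α (M.inf (Function.update μ S (M.updOut μ S))) := fun μ S α h =>
    h.of_updOut_le (BuchiAut.updOut_le_of_eq_or (BuchiAut.update_updOut_eq_or μ S))
  refine ⟨fun μ S => ⟨fun α _ => trub_update μ S α, fun h α hα => trub_update μ S α (h α hα),
      fun h => h.of_eq_zero_or
        (BuchiAut.eq_zero_or_of_eq_or (BuchiAut.update_updOut_eq_or μ S))⟩,
    fun μ₀ => ⟨BuchiAut.outerTerminates μ₀, BuchiAut.existsUnique_outerReturns μ₀⟩,
    fun μ₀ μs h => ⟨fun α _ => trub μ₀ μs h α, fun h0 α hα => trub μ₀ μs h α (h0 α hα), ?_⟩⟩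
  exact h.preserves (P := fun μ => M.IsRankingValued (M.inf μ)) fun _ _ hs hμ =>
    hμ.of_eq_zero_or (BuchiAut.eq_zero_or_of_eq_or hs.2)
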